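/- Let rings be associative with unit and modules unital. A ring $R$ is called right $\mathcal F_1^{\mathrm{fp}}$-coherent if every finitely generated flat submodule of a free right $R$-module is finitely presented. Then the following hold. 1. Every right semi-hereditary ring (every finitely generated right ideal is projective) is right $\mathcal F_1^{\mathrm{fp}}$-coherent. 2. Every right coherent ring (every finitely generated right ideal is finitely presented), and thus every right Noetherian ring, is right $\mathcal F_1^{\mathrm{fp}}$-coherent. 3. Every right perfect ring (every right module has a projective cover) is right $\mathcal F_1^{\mathrm{fp}}$-coherent. 4. Every commutative ring $R$ that is semi-coherent in the sense of Matlis, i.e. such that $\operatorname{Hom}_R(B,C)$ is isomorphic to a submodule of a flat $R$-module for all injective $R$-modules $B$ and $C$, is right $\mathcal F_1^{\mathrm{fp}}$-coherent. 5. Every (commutative) integral domain is right $\mathcal F_1^{\mathrm{fp}}$-coherent. -/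

import Mathlib

/-!
Right modules over a ring `R` are, as everywhere in Mathlib, modules over `Rᵐᵒᵖ`; `MulOpposite.op r • m`
is the right action `m r`. In particular a right ideal of `R` is a `Submodule Rᵐᵒᵖ R`, where `R`
acts on itself by right multiplication.
-/

universe u v w w'

open scoped TensorProduct

section BalancedTensor

variable (R : Type u) [Ring R] (M : Type v) [AddCommGroup M] [Module Rᵐᵒᵖ M]

/-- The subgroup of `M ⊗[ℤ] N` generated by the elements `m r ⊗ n - m ⊗ r n`. -/
def balancedRelations (N : Type w) [AddCommGroup N] [Module R N] : AddSubgroup (M ⊗[ℤ] N) :=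
  AddSubgroup.closure {t | ∃ (m : M) (r : R) (n : N),
    t = (MulOpposite.op r • m) ⊗ₜ[ℤ] n - m ⊗ₜ[ℤ] (r • n)}

/-- The tensor product `M ⊗_R N` (an abelian group) of a right module `M` and a left module `N`
over a ring `R` that need not be commutative. -/
abbrev BalancedTensor (N : Type w) [AddCommGroup N] [Module R N] : Type (max v w) :=
  (M ⊗[ℤ] N) ⧸ balancedRelations R M N

theorem balancedRelations_le_comap {N : Type w} [AddCommGroup N] [Module R N]
    {N' : Type w'} [AddCommGroup N'] [Module R N'] (f : N →ₗ[R] N') :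
    balancedRelations R M N ≤
      (balancedRelations R M N').comap
        (f.toAddMonoidHom.toIntLinearMap.lTensor M).toAddMonoidHom := by
  refine (AddSubgroup.closure_le _).2 ?_
  rintro _ ⟨m, r, n, rfl⟩
  refine AddSubgroup.subset_closure ⟨m, r, f n, ?_⟩
  simp

/-- The map `id ⊗ f : M ⊗_R N → M ⊗_R N'` induced by an `R`-linear map `f : N → N'` of left
modules. -/
def BalancedTensor.map {N : Type w} [AddCommGroup N] [Module R N]
    {N' : Type w'} [AddCommGroup N'] [Module R N'] (f : N →ₗ[R] N') :
    BalancedTensor R M N →+ BalancedTensor R M N' :=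
  QuotientAddGroup.map (balancedRelations R M N) (balancedRelations R M N')
    (f.toAddMonoidHom.toIntLinearMap.lTensor M).toAddMonoidHom
    (balancedRelations_le_comap R M f)

/-- A right `R`-module `M` is flat if `M ⊗_R -` preserves injectivity of maps of left `R`-modules. -/
def IsFlatRightModule : Prop :=
  ∀ ⦃N N' : Type u⦄ [AddCommGroup N] [AddCommGroup N'] [Module R N] [Module R N']
    (f : N →ₗ[R] N'), Function.Injective f → Function.Injective (BalancedTensor.map R M f)

end BalancedTensor

/-- `R` is right `F₁^fp`-coherent: every finitely generated flat submodule of a free right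
`R`-module is finitely presented. -/
def IsRightF1fpCoherent (R : Type u) [Ring R] : Prop :=
  ∀ (F : Type u) [AddCommGroup F] [Module Rᵐᵒᵖ F] [Module.Free Rᵐᵒᵖ F] (M : Submodule Rᵐᵒᵖ F),
    M.FG → IsFlatRightModule R M → Module.FinitePresentation Rᵐᵒᵖ M

/-- `R` is right semi-hereditary: every finitely generated right ideal is projective. -/
def IsRightSemihereditary (R : Type u) [Ring R] : Prop :=
  ∀ I : Submodule Rᵐᵒᵖ R, I.FG → Module.Projective Rᵐᵒᵖ I

/-- `R` is right coherent: every finitely generated right ideal is finitely presented. -/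
def IsRightCoherent (R : Type u) [Ring R] : Prop :=
  ∀ I : Submodule Rᵐᵒᵖ R, I.FG → Module.FinitePresentation Rᵐᵒᵖ I

/-- `R` is right Noetherian: every right ideal is finitely generated. -/
def IsRightNoetherian (R : Type u) [Ring R] : Prop :=
  IsNoetherian Rᵐᵒᵖ R

/-- A submodule `K` of `P` is superfluous (small) if `L + K = P` implies `L = P`. -/
def IsSuperfluous {S : Type u} [Ring S] {P : Type v} [AddCommGroup P] [Module S P]
    (K : Submodule S P) : Prop :=
  ∀ L : Submodule S P, L ⊔ K = ⊤ → L = ⊤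

/-- `p : P → M` is a projective cover of `M`. -/
def IsProjectiveCover {S : Type u} [Ring S] {P : Type v} [AddCommGroup P] [Module S P]
    {M : Type w} [AddCommGroup M] [Module S M] (p : P →ₗ[S] M) : Prop :=
  Module.Projective S P ∧ Function.Surjective p ∧ IsSuperfluous (LinearMap.ker p)

/-- `R` is right perfect: every right `R`-module has a projective cover. -/
def IsRightPerfect (R : Type u) [Ring R] : Prop :=
  ∀ (M : Type u) [AddCommGroup M] [Module Rᵐᵒᵖ M],
    ∃ (P : Type u) (_ : AddCommGroup P) (_ : Module Rᵐᵒᵖ P) (p : P →ₗ[Rᵐᵒᵖ] M),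
      IsProjectiveCover p

/-- A commutative ring `R` is semi-coherent (in the sense of Matlis) if for all injective
`R`-modules `B` and `C` the `R`-module `Hom_R(B, C)` embeds in a flat `R`-module. -/
def IsMatlisSemicoherent (R : Type u) [CommRing R] : Prop :=
  ∀ (B C : Type u) [AddCommGroup B] [AddCommGroup C] [Module R B] [Module R C],
    Module.Injective R B → Module.Injective R C →
      ∃ (F : Type u) (_ : AddCommGroup F) (_ : Module R F) (j : (B →ₗ[R] C) →ₗ[R] F),
        Module.Flat R F ∧ Function.Injective j

/-! Three arguments carry the result. Over a coherent ring, flatness plays no role: a finitely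
generated submodule of a free module meets finitely many coordinates, which are split off one by
one; semihereditary and Noetherian rings are coherent. Over a perfect ring, a flat module is its own
projective cover: flatness (`IsFlatRightModule.exists_mem_ker`) puts each element of the kernel in
the fixed points of an endomorphism with values in the small kernel, hence makes it zero. Matlis
semi-coherent rings and domains satisfy `PowersEmbedInFlat`. Then all relations among generators of
`M`, indexed by a set `X`, form one tensor in `M ⊗ S^X`; it vanishes, and the equational criterion
writes them through finitely many relations. -/

/-! ### Flat modules and projective covers. -/

open MulOpposite in
/-- If `P → M` is a surjection of right modules onto a flat module, with kernel `K`, then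
`K ∩ P I = K I` for every finitely generated left ideal `I`. -/
theorem IsFlatRightModule.exists_mem_ker {R : Type u} [Ring R] {M : Type v} [AddCommGroup M]
    [Module Rᵐᵒᵖ M] (hM : IsFlatRightModule R M) {P : Type w} [AddCommGroup P] [Module Rᵐᵒᵖ P]
    (p : P →ₗ[Rᵐᵒᵖ] M) (hp : Function.Surjective p) {ι : Type w'} [Fintype ι] (x : ι → P)
    (r : ι → R) (h : p (∑ i, op (r i) • x i) = 0) :
    ∃ k : ι → P, (∀ i, p (k i) = 0) ∧ ∑ i, op (r i) • x i = ∑ i, op (r i) • k i := by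
  let I : Submodule R R := Submodule.span R (Set.range r)
  -- `A` is `K I`. Modulo `A`, `y s` depends only on `p y`, so `m ⊗ s ↦ σ(m) s` is well defined on
  -- `M ⊗_R I` for any set-theoretic section `σ`.
  let A : AddSubgroup P :=
    { carrier := {y | ∃ k : ι → P, (∀ i, p (k i) = 0) ∧ y = ∑ i, op (r i) • k i}
      zero_mem' := ⟨0, by simp, by simp⟩
      add_mem' := by
        rintro _ _ ⟨k, hk, rfl⟩ ⟨k', hk', rfl⟩
        exact ⟨k + k', by simp [hk, hk'], by simp [smul_add, Finset.sum_add_distrib]⟩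
      neg_mem' := by
        rintro _ ⟨k, hk, rfl⟩
        exact ⟨-k, by simp [hk], by simp⟩ }
  have hA (s : I) (y z : P) (hyz : p y = p z) :
      QuotientAddGroup.mk' A (op (s : R) • y) = QuotientAddGroup.mk' A (op (s : R) • z) := by
    obtain ⟨a, ha⟩ := (Submodule.mem_span_range_iff_exists_fun R).1 s.2
    rw [← sub_eq_zero, ← map_sub, ← smul_sub]
    refine (QuotientAddGroup.eq_zero_iff _).2 ⟨fun i => op (a i) • (y - z), by simp [hyz], ?_⟩
    simp only [← ha, smul_eq_mul, Finset.op_sum, op_mul, Finset.sum_smul, mul_smul]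
  let σ := Function.surjInv hp
  have hσ (m : M) : p (σ m) = m := Function.surjInv_eq hp m
  let β : M →+ I →+ P ⧸ A := AddMonoidHom.mk'
    (fun m => AddMonoidHom.mk' (fun s => QuotientAddGroup.mk' A (op (s : R) • σ m))
      fun s t => by simp only [← map_add, Submodule.coe_add, op_add, add_smul])
    fun m m' => by
      ext s
      simp only [AddMonoidHom.mk'_apply, AddMonoidHom.add_apply, ← map_add, ← smul_add]
      exact hA s _ _ (by simp [hσ])
  let φ : M ⊗[ℤ] I →+ P ⧸ A := TensorProduct.liftAddHom β fun n m s => by simp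
  have hφ : balancedRelations R M I ≤ φ.ker := by
    refine (AddSubgroup.closure_le _).2 ?_
    rintro _ ⟨m, a, s, rfl⟩
    rw [SetLike.mem_coe, AddMonoidHom.mem_ker, map_sub, sub_eq_zero]
    change QuotientAddGroup.mk' A (op (s : R) • σ (op a • m)) =
      QuotientAddGroup.mk' A (op ((a • s : I) : R) • σ m)
    rw [hA s _ (op a • σ m) (by simp [hσ])]
    simp [mul_smul]
  let ψ : BalancedTensor R M I →+ P ⧸ A := QuotientAddGroup.lift _ φ hφ
  let s : ι → I := fun i => ⟨r i, Submodule.subset_span ⟨i, rfl⟩⟩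
  let t : M ⊗[ℤ] I := ∑ i, p (x i) ⊗ₜ s i
  -- By flatness this can be tested in `M ⊗_R R`, where `t` becomes `(∑ p(x i) r i) ⊗ 1 = 0`.
  have ht : (QuotientAddGroup.mk t : BalancedTensor R M I) = 0 := by
    apply hM I.subtype I.injective_subtype
    rw [map_zero]
    refine (QuotientAddGroup.eq_zero_iff _).2 ?_
    have h1 : (I.subtype.toAddMonoidHom.toIntLinearMap.lTensor M) t =
        ∑ i, p (x i) ⊗ₜ[ℤ] (r i) := by simp [t, s]
    have h2 : ∑ i, (op (r i) • p (x i)) ⊗ₜ[ℤ] (1 : R) = 0 := by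
      simp only [← TensorProduct.sum_tmul, ← map_smul, ← map_sum, h, TensorProduct.zero_tmul]
    have h3 : (I.subtype.toAddMonoidHom.toIntLinearMap.lTensor M) t =
        -∑ i, ((op (r i) • p (x i)) ⊗ₜ[ℤ] (1 : R) - p (x i) ⊗ₜ[ℤ] (r i • (1 : R))) := by
      rw [Finset.sum_sub_distrib, h2, h1]; simp
    change (I.subtype.toAddMonoidHom.toIntLinearMap.lTensor M) t ∈ _
    rw [h3]
    exact neg_mem (sum_mem fun i _ => AddSubgroup.subset_closure ⟨_, _, _, rfl⟩)
  have h0 : φ t = 0 := by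
    change ψ (QuotientAddGroup.mk t) = 0
    rw [ht, map_zero]
  have h1 : φ t = QuotientAddGroup.mk' A (∑ i, op (r i) • x i) := by
    rw [map_sum, map_sum]
    refine Finset.sum_congr rfl fun i _ => ?_
    change QuotientAddGroup.mk' A (op (s i : R) • σ (p (x i))) = _
    exact hA (s i) _ _ (hσ _)
  exact (QuotientAddGroup.eq_zero_iff _).1 (h1.symm.trans h0)

/-- `1 - θ` is onto because its image together with `K` spans `P`. A section `g` is onto for the
same reason, as `ker (1 - θ) ≤ K`; hence `1 - θ` is injective. -/
theorem LinearMap.eq_zero_of_apply_eq_self_of_isSuperfluous {S : Type u} [Ring S] {P : Type v}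
    [AddCommGroup P] [Module S P] [Module.Projective S P] {K : Submodule S P}
    (hK : IsSuperfluous K) (θ : P →ₗ[S] P) (hθ : ∀ y, θ y ∈ K) {x : P} (hx : θ x = x) :
    x = 0 := by
  have hs : Function.Surjective ((LinearMap.id : P →ₗ[S] P) - θ) := by
    refine LinearMap.range_eq_top.1 (hK _ (eq_top_iff.2 fun y _ => ?_))
    exact Submodule.mem_sup.2 ⟨((LinearMap.id : P →ₗ[S] P) - θ) y, ⟨y, rfl⟩, θ y, hθ y, by simp⟩
  obtain ⟨g, hg⟩ := Module.projective_lifting_property (LinearMap.id - θ) LinearMap.id hs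
  have hg' (y : P) : g y - θ (g y) = y := LinearMap.congr_fun hg y
  have hgs : LinearMap.range g = ⊤ := by
    refine hK _ (eq_top_iff.2 fun y _ => ?_)
    refine Submodule.mem_sup.2 ⟨g (y - θ y), ⟨_, rfl⟩, y - g (y - θ y), ?_, by simp⟩
    have h1 := hg' (y - θ y)
    have h2 : y - g (y - θ y) = θ (y - g (y - θ y)) := by
      rw [map_sub θ, sub_eq_sub_iff_sub_eq_sub]
      exact h1.symm
    rw [h2]
    exact hθ _
  obtain ⟨y, rfl⟩ := LinearMap.range_eq_top.1 hgs x
  rw [← hg' y, hx, sub_self, map_zero]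

open MulOpposite in
/-- A flat right module with a projective cover is projective. -/
theorem IsFlatRightModule.projective_of_isProjectiveCover {R : Type u} [Ring R] {M : Type v}
    [AddCommGroup M] [Module Rᵐᵒᵖ M] (hM : IsFlatRightModule R M) {P : Type w} [AddCommGroup P]
    [Module Rᵐᵒᵖ P] {p : P →ₗ[Rᵐᵒᵖ] M} (hp : IsProjectiveCover p) :
    Module.Projective Rᵐᵒᵖ M := by
  obtain ⟨hP, hs, hK⟩ := hp
  suffices hi : Function.Injective p from
    Module.Projective.of_equiv (LinearEquiv.ofBijective p ⟨hi, hs⟩)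
  refine (injective_iff_map_eq_zero p).2 fun x hx => ?_
  obtain ⟨c, hc⟩ := Module.projective_def.1 hP
  have hcx : ∑ i : (c x).support, op (unop (c x i)) • (i : P) = x := by
    conv_rhs => rw [← hc x, Finsupp.linearCombination_apply, Finsupp.sum, ← Finset.sum_coe_sort]
    rfl
  obtain ⟨k, hk, hkx⟩ := hM.exists_mem_ker p hs (fun i : (c x).support => (i : P))
    (fun i => unop (c x i)) (by rw [hcx, hx])
  -- In the dual basis expansion of `y`, the terms from the support of `c x` are kept, with each
  -- generator `i` replaced by `k i` in the kernel.
  let θ : P →ₗ[Rᵐᵒᵖ] P :=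
    ∑ i : (c x).support, (LinearMap.toSpanSingleton Rᵐᵒᵖ P (k i)) ∘ₗ Finsupp.lapply (i : P) ∘ₗ c
  refine LinearMap.eq_zero_of_apply_eq_self_of_isSuperfluous hK θ (fun y => ?_) ?_
  · simp [θ, hk]
  · rw [hcx] at hkx
    conv_rhs => rw [hkx]
    simp [θ]

theorem IsRightPerfect.isRightF1fpCoherent {R : Type u} [Ring R] (hR : IsRightPerfect R) :
    IsRightF1fpCoherent R := by
  intro F _ _ _ M hfg hM
  obtain ⟨P, _, _, p, hp⟩ := hR M
  have := hM.projective_of_isProjectiveCover hp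
  have : Module.Finite Rᵐᵒᵖ M := Module.Finite.iff_fg.2 hfg
  exact Module.finitePresentation_of_projective Rᵐᵒᵖ M

/-! ### Coherent rings. -/

/-- Right multiplication identifies the regular right module with `Rᵐᵒᵖ` over itself. -/
def regularRightModuleEquiv (R : Type u) [Ring R] : Rᵐᵒᵖ ≃ₗ[Rᵐᵒᵖ] R where
  toFun := MulOpposite.unop
  invFun := MulOpposite.op
  map_add' _ _ := rfl
  map_smul' _ _ := rfl
  left_inv _ := rfl
  right_inv _ := rfl

/-- The kernel of `M → f(M)` is finitely generated because `f(M)` is finitely presented; an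
extension of finitely presented modules is finitely presented. -/
theorem Submodule.finitePresentation_of_map_of_inf_ker {S : Type u} [Ring S] {F : Type v}
    [AddCommGroup F] [Module S F] {N : Type w} [AddCommGroup N] [Module S N] (M : Submodule S F)
    (hM : M.FG) (f : F →ₗ[S] N) [Module.FinitePresentation S (M.map f)]
    (h : (M ⊓ LinearMap.ker f).FG →
      Module.FinitePresentation S (M ⊓ LinearMap.ker f : Submodule S F)) :
    Module.FinitePresentation S M := by
  let g : M →ₗ[S] M.map f := f.submoduleMap M
  have hg : Function.Surjective g := f.submoduleMap_surjective M
  have : Module.Finite S M := Module.Finite.iff_fg.2 hM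
  have hker : (LinearMap.ker g).map M.subtype = M ⊓ LinearMap.ker f := by
    ext x
    simp [g, Subtype.ext_iff, and_comm]
  have := h (hker ▸ (Module.FinitePresentation.fg_ker g hg).map _)
  rw [← hker] at this
  let e := Submodule.equivMapOfInjective M.subtype M.injective_subtype (LinearMap.ker g)
  have : Module.FinitePresentation S (LinearMap.ker g) := e.finitePresentation_iff.2 this
  exact Module.finitePresentation_of_ker g hg

theorem IsRightCoherent.finitePresentation_of_fg {R : Type u} [Ring R] (hR : IsRightCoherent R)
    {F : Type v} [AddCommGroup F] [Module Rᵐᵒᵖ F] {ι : Type w} (b : Module.Basis ι Rᵐᵒᵖ F)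
    (s : Finset ι) (M : Submodule Rᵐᵒᵖ F) (hM : M.FG) (hs : ∀ m ∈ M, (b.repr m).support ⊆ s) :
    Module.FinitePresentation Rᵐᵒᵖ M := by
  classical
  induction s using Finset.induction_on generalizing M with
  | empty =>
    have : Subsingleton M := ⟨fun x y => by
      have h (z : M) : (z : F) = 0 := by simpa using hs z z.2
      exact Subtype.ext ((h x).trans (h y).symm)⟩
    infer_instance
  | insert a s _ ih =>
    let f : F →ₗ[Rᵐᵒᵖ] R := (regularRightModuleEquiv R).toLinearMap ∘ₗ b.coord a
    have : Module.FinitePresentation Rᵐᵒᵖ (M.map f) := hR _ (hM.map f)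
    refine M.finitePresentation_of_map_of_inf_ker hM f fun hker => ih _ hker ?_
    intro m hm i hi
    refine (Finset.mem_insert.1 (hs m hm.1 hi)).resolve_left ?_
    rintro rfl
    have h' : b.repr m i = 0 :=
      (regularRightModuleEquiv R).map_eq_zero_iff.1 (LinearMap.mem_ker.1 hm.2)
    exact Finsupp.mem_support_iff.1 hi h'

theorem IsRightCoherent.isRightF1fpCoherent {R : Type u} [Ring R] (hR : IsRightCoherent R) :
    IsRightF1fpCoherent R := by
  classical
  intro F _ _ _ M hfg _
  let b := Module.Free.chooseBasis Rᵐᵒᵖ F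
  obtain ⟨t, ht⟩ := id hfg
  refine hR.finitePresentation_of_fg b (t.biUnion fun x => (b.repr x).support) M hfg fun m hm => ?_
  have hle : M ≤ (Finsupp.supported Rᵐᵒᵖ Rᵐᵒᵖ
      (↑(t.biUnion fun x => (b.repr x).support) : Set _)).comap b.repr.toLinearMap := by
    rw [← ht, Submodule.span_le]
    intro x hx
    exact (Finsupp.mem_supported Rᵐᵒᵖ _).2 (Finset.coe_subset.2
      (Finset.subset_biUnion_of_mem (fun x => (b.repr x).support) hx))
  exact Finset.coe_subset.1 ((Finsupp.mem_supported Rᵐᵒᵖ _).1 (hle hm))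

theorem IsRightSemihereditary.isRightCoherent {R : Type u} [Ring R]
    (hR : IsRightSemihereditary R) : IsRightCoherent R := by
  intro I hI
  have := hR I hI
  have : Module.Finite Rᵐᵒᵖ I := Module.Finite.iff_fg.2 hI
  exact Module.finitePresentation_of_projective Rᵐᵒᵖ I

theorem IsRightNoetherian.isRightCoherent {R : Type u} [Ring R]
    (hR : IsRightNoetherian R) : IsRightCoherent R := by
  intro I hI
  have : IsNoetherian Rᵐᵒᵖ R := hR
  have : IsNoetherianRing Rᵐᵒᵖ := isNoetherian_of_linearEquiv (regularRightModuleEquiv R).symm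
  have : Module.Finite Rᵐᵒᵖ I := Module.Finite.iff_fg.2 hI
  exact Module.finitePresentation_of_finite Rᵐᵒᵖ I

/-! ### Commutative rings whose powers embed in flat modules. -/

-- A relation in `M` lifts to the free module on the set `M`; correcting by elements of the kernel
-- turns it into a true relation there, which is trivial, and its trivialization maps back to `M`.
open MulOpposite in
theorem IsFlatRightModule.flat {R : Type u} [CommRing R] {M : Type v} [AddCommGroup M]
    [Module Rᵐᵒᵖ M] (hM : IsFlatRightModule R M) : Module.Flat Rᵐᵒᵖ M := by
  refine Module.Flat.of_forall_isTrivialRelation fun {l f x} hfx => ?_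
  let p : (M →₀ Rᵐᵒᵖ) →ₗ[Rᵐᵒᵖ] M := Finsupp.linearCombination Rᵐᵒᵖ id
  have hp1 (m : M) : p (Finsupp.single m 1) = m := by simp [p]
  obtain ⟨k, hk, hkx⟩ := hM.exists_mem_ker p (fun m => ⟨_, hp1 m⟩)
    (fun i => Finsupp.single (x i) 1) (fun i => unop (f i)) (by simpa [p] using hfx)
  have h0 : ∑ i, f i • (Finsupp.single (x i) 1 - k i) = 0 := by
    simpa [smul_sub, sub_eq_zero] using hkx
  obtain ⟨n, a, y, hxy, hfa⟩ := Module.Flat.isTrivialRelation_of_sum_smul_eq_zero h0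
  refine ⟨n, a, fun j => p (y j), fun i => ?_, hfa⟩
  simp only [← map_smul, ← map_sum, ← hxy, map_sub, hp1, hk, sub_zero]

/-- Every power of `S` embeds in a flat module. -/
def PowersEmbedInFlat (S : Type u) [CommRing S] : Prop :=
  ∀ X : Type u, ∃ (G : Type u) (_ : AddCommGroup G) (_ : Module S G) (j : (X → S) →ₗ[S] G),
    Module.Flat S G ∧ Function.Injective j

theorem PowersEmbedInFlat.finitePresentation {S : Type u} [CommRing S] (hS : PowersEmbedInFlat S)
    {F : Type v} [AddCommGroup F] [Module S F] [Module.Free S F] (M : Submodule S F) (hfg : M.FG)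
    [Module.Flat S M] : Module.FinitePresentation S M := by
  have : Module.Finite S M := Module.Finite.iff_fg.2 hfg
  obtain ⟨n, q, hq⟩ := Module.Finite.exists_fin' S M
  refine Module.finitePresentation_of_free_of_surjective q hq ?_
  obtain ⟨G, _, _, j, hG, hj⟩ := hS (LinearMap.ker q)
  let m : Fin n → M := fun i => q (Pi.single i 1)
  have hqm (v : Fin n → S) : q v = ∑ i, v i • m i := by
    conv_lhs => rw [pi_eq_sum_univ' v, map_sum]
    simp [m, Pi.single]
  have hm : Submodule.span S (Set.range m) = ⊤ := by
    refine eq_top_iff.2 fun z _ => ?_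
    obtain ⟨v, rfl⟩ := hq z
    rw [hqm]
    exact sum_mem fun i _ => Submodule.smul_mem _ _ (Submodule.subset_span ⟨i, rfl⟩)
  -- The exponent is `ker q` itself, so that `∑ m i ⊗ c i` encodes every relation at once.
  let c : Fin n → LinearMap.ker q → S := fun i v => (v : Fin n → S) i
  have hmc (φ : M →ₗ[S] S) : ∑ i, φ (m i) • c i = 0 := by
    ext v
    have h : φ (q v) = 0 := by rw [v.2, map_zero]
    simpa [hqm, c, mul_comm] using h
  have hc : ∑ i, m i ⊗ₜ[S] c i = 0 := by
    -- `M ⊗ S^X → M ⊗ G → F ⊗ G` is injective by flatness of `M`, then of `G`; in `F ⊗ G` vanishing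
    -- is checked on coordinates of `F`.
    apply Module.Flat.lTensor_preserves_injective_linearMap (M := M) j hj
    apply Module.Flat.rTensor_preserves_injective_linearMap (M := G) M.subtype M.injective_subtype
    let b := Module.Free.chooseBasis S F
    apply (TensorProduct.equivFinsuppOfBasisLeft b).injective
    ext e
    have h := congrArg j (hmc (b.coord e ∘ₗ M.subtype))
    simpa using h
  obtain ⟨l, a, y, hcy, ham⟩ := TensorProduct.vanishesTrivially_of_sum_tmul_eq_zero S hm hc
  have hker : LinearMap.ker q = Submodule.span S (Set.range fun t => fun i => a i t) := by
    refine le_antisymm (fun v hv => ?_) (Submodule.span_le.2 ?_)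
    · have hv' : v = ∑ t, y t ⟨v, hv⟩ • fun i => a i t := by
        ext i
        have h := congrFun (hcy i) ⟨v, hv⟩
        simpa [c, mul_comm] using h
      rw [hv']
      exact sum_mem fun t _ => Submodule.smul_mem _ _ (Submodule.subset_span ⟨t, rfl⟩)
    · rintro _ ⟨t, rfl⟩
      exact LinearMap.mem_ker.2 ((hqm _).trans (ham t))
  rw [hker]
  exact Submodule.fg_span (Set.finite_range _)

theorem PowersEmbedInFlat.of_ringEquiv {R S : Type u} [CommRing R] [CommRing S]
    (hR : PowersEmbedInFlat R) (e : S ≃+* R) : PowersEmbedInFlat S := by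
  intro X
  obtain ⟨G, _, _, j, hG, hj⟩ := hR X
  let _ : Algebra S R := e.toRingHom.toAlgebra
  let _ : Module S G := Module.compHom G e.toRingHom
  have : IsScalarTower S R G := ⟨fun s r g => mul_smul (e s) r g⟩
  let f : S ≃ₗ[S] R := { e with map_smul' := fun s t => map_mul e s t }
  have : Module.Flat S R := Module.Flat.of_linearEquiv f.symm
  refine ⟨G, inferInstance, inferInstance,
    j.restrictScalars S ∘ₗ f.toLinearMap.compLeft X, Module.Flat.trans S R G, ?_⟩
  exact hj.comp f.injective.comp_left

theorem PowersEmbedInFlat.isRightF1fpCoherent {R : Type u} [CommRing R]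
    (hR : PowersEmbedInFlat R) : IsRightF1fpCoherent R := by
  intro F _ _ _ M hfg hM
  have := hM.flat
  exact (hR.of_ringEquiv (RingEquiv.toOpposite R).symm).finitePresentation M hfg

theorem IsMatlisSemicoherent.powersEmbedInFlat {R : Type u} [CommRing R]
    (hR : IsMatlisSemicoherent R) : PowersEmbedInFlat R := by
  intro X
  obtain ⟨E⟩ := CategoryTheory.EnoughInjectives.presentation (ModuleCat.of R R)
  have hE : Module.Injective R E.J := Module.injective_module_of_injective_object R E.J (inj := E.injective)
  obtain ⟨G, _, _, j, hG, hj⟩ := hR E.J (X → E.J) hE inferInstance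
  -- `R^X` acts on an injective module containing `R` by coordinatewise multiplication; evaluating
  -- at the image of `1` recovers the scalars.
  let h : (X → R) →ₗ[R] (E.J →ₗ[R] (X → E.J)) :=
    { toFun := fun v => LinearMap.pi fun x => v x • LinearMap.id
      map_add' := fun v w => by ext; simp [add_smul]
      map_smul' := fun r v => by ext; simp [mul_smul] }
  refine ⟨G, inferInstance, inferInstance, j ∘ₗ h, hG, hj.comp fun v w hvw => ?_⟩
  have hf : Function.Injective E.f.hom := (ModuleCat.mono_iff_injective E.f).1 E.mono
  ext x
  have h1 := congrFun (LinearMap.congr_fun hvw (E.f.hom (1 : R))) x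
  apply hf
  simpa [h, ← map_smul] using h1

theorem IsDomain.powersEmbedInFlat (R : Type u) [CommRing R] [IsDomain R] :
    PowersEmbedInFlat R := fun X =>
  have := IsLocalization.flat (FractionRing R) (nonZeroDivisors R)
  ⟨X → FractionRing R, inferInstance, inferInstance,
    (Algebra.linearMap R (FractionRing R)).compLeft X,
    Module.Flat.trans R (FractionRing R) (X → FractionRing R),
    (IsFractionRing.injective R (FractionRing R)).comp_left⟩

theorem proposition3p1 :
    (∀ (R : Type u) [Ring R], IsRightSemihereditary R → IsRightF1fpCoherent R) ∧
    (∀ (R : Type u) [Ring R], IsRightCoherent R → IsRightF1fpCoherent R) ∧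
    (∀ (R : Type u) [Ring R], IsRightNoetherian R → IsRightF1fpCoherent R) ∧
    (∀ (R : Type u) [Ring R], IsRightPerfect R → IsRightF1fpCoherent R) ∧
    (∀ (R : Type u) [CommRing R], IsMatlisSemicoherent R → IsRightF1fpCoherent R) ∧
    (∀ (R : Type u) [CommRing R] [IsDomain R], IsRightF1fpCoherent R) :=
  ⟨fun _ _ h => h.isRightCoherent.isRightF1fpCoherent, fun _ _ h => h.isRightF1fpCoherent,
    fun _ _ h => h.isRightCoherent.isRightF1fpCoherent, fun _ _ h => h.isRightF1fpCoherent,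
    fun _ _ h => h.powersEmbedInFlat.isRightF1fpCoherent,
    fun R _ _ => (IsDomain.powersEmbedInFlat R).isRightF1fpCoherent⟩
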